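/- Corollary 4.1. Let $K$ be a field of characteristic $0$ and let $n \geq 4$. Let $L_n$ be the free Lie algebra over $K$ with free generators $x_1, \dots, x_n$. For a Lie algebra $L$ write $L' = [L, L]$ and $\gamma_3(L) = [[L, L], L]$, and let commutators be left-normed, i.e. $[a_1, \dots, a_m] = [[a_1, \dots, a_{m-1}], a_m]$. Put $I_n = \gamma_3(L_n') + (\gamma_3(L_n))'$, $R_n = L_n/I_n$ and $y_i = x_i + I_n$ for $1 \leq i \leq n$. Then, for each $\kappa \in \{1, 2, 3\}$, there is exactly one Lie algebra automorphism $\omega_\kappa$ of $R_n$ such that $$\omega_\kappa(y_1) = y_1 + [y_1, y_2, \underbrace{y_1, \dots, y_1}_{\kappa - 1}, [y_3, y_4]], \qquad \omega_\kappa(y_j) = y_j \quad (2 \leq j \leq n),$$ and $\omega_\kappa$ is non-tame, that is, it is not induced by any automorphism of $L_n$: there is no automorphism $\psi$ of $L_n$ with $\omega_\kappa(u + I_n) = \psi(u) + I_n$ for all $u \in L_n$. -/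

import Mathlib

namespace FreeLieTame



/-- `γ₃(J) = [J, J, J]` for an ideal `J` of a Lie algebra `L`, as an ideal of `L`
(the product of two ideals of `L` is again an ideal of `L`). -/
def gammaThree {K L : Type*} [CommRing K] [LieRing L] [LieAlgebra K L]
    (J : LieIdeal K L) : LieIdeal K L := ⁅⁅J, J⁆, J⁆

/-- The derived algebra `J' = [J, J]` of an ideal `J` of `L`, as an ideal of `L`. -/
def derivedIdeal {K L : Type*} [CommRing K] [LieRing L] [LieAlgebra K L]
    (J : LieIdeal K L) : LieIdeal K L := ⁅J, J⁆

/-- The ideal `γ₃(L') + (γ₃(L))'` of `L`. -/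
def relIdeal (K L : Type*) [CommRing K] [LieRing L] [LieAlgebra K L] : LieIdeal K L :=
  gammaThree (derivedIdeal (⊤ : LieIdeal K L)) ⊔ derivedIdeal (gammaThree (⊤ : LieIdeal K L))


/-- The left-normed commutator `[a, b, …, b]` with `k` copies of `b`; it is `a` for `k = 0`. -/
def repeatedLie {L : Type*} [LieRing L] (a b : L) : ℕ → L
  | 0 => a
  | k + 1 => ⁅repeatedLie a b k, b⁆

section RelativelyFree

variable (K : Type*) [Field K] (n : ℕ)

/-- `R_n = L_n / (γ₃(L_n') + (γ₃(L_n))')`, where `L_n` is the free Lie algebra of rank `n`. -/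
abbrev RelFree : Type _ := FreeLieAlgebra K (Fin n) ⧸ relIdeal K (FreeLieAlgebra K (Fin n))

variable {n}

/-- The free generator `y i = x i + (γ₃(L_n') + (γ₃(L_n))')` of `R_n` (indices start at `0`). -/
noncomputable def gen (i : Fin n) : RelFree K n :=
  LieSubmodule.Quotient.mk (N := relIdeal K (FreeLieAlgebra K (Fin n))) (FreeLieAlgebra.of K i)

variable {K}

/-- An automorphism of `R_n` is tame if it is induced by an automorphism of `L_n`. -/
def IsTame (φ : RelFree K n ≃ₗ⁅K⁆ RelFree K n) : Prop :=
  ∃ ψ : FreeLieAlgebra K (Fin n) ≃ₗ⁅K⁆ FreeLieAlgebra K (Fin n),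
    ∀ u : FreeLieAlgebra K (Fin n),
      φ (LieSubmodule.Quotient.mk (N := relIdeal K (FreeLieAlgebra K (Fin n))) u) =
        LieSubmodule.Quotient.mk (N := relIdeal K (FreeLieAlgebra K (Fin n))) (ψ u)

/-- `φ` has the defining values of `ω_κ` (for `κ ≥ 1`) on the free generators `y₁, …, y_n`:
`φ(y₁) = y₁ + [y₁, y₂, y₁, …, y₁, [y₃, y₄]]` with `κ - 1` copies of `y₁` between `y₂` and
`[y₃, y₄]` (left-normed), and `φ(y_j) = y_j` for all `j ≥ 2`. Here `y₁, y₂, y₃, y₄` are the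
generators with indices `0, 1, 2, 3`. -/
def IsOmega (hn : 4 ≤ n) (κ : ℕ) (φ : RelFree K n ≃ₗ⁅K⁆ RelFree K n) : Prop :=
  φ (gen K (Fin.castLE hn 0)) = gen K (Fin.castLE hn 0) +
      ⁅repeatedLie ⁅gen K (Fin.castLE hn 0), gen K (Fin.castLE hn 1)⁆
          (gen K (Fin.castLE hn 0)) (κ - 1),
        ⁅gen K (Fin.castLE hn 2), gen K (Fin.castLE hn 3)⁆⁆ ∧
    ∀ j : Fin n, j ≠ Fin.castLE hn 0 → φ (gen K j) = gen K j

end RelativelyFree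

end FreeLieTame

namespace FreeLieTame

open Polynomial Matrix

/-! ### Fox derivatives and the Jacobian of an automorphism. -/

section FoxDerivations

attribute [local instance] LieRing.ofAssociativeRing

variable {K : Type*} [Field K] {X : Type*}

/-! Non-tameness comes from a determinant. The Fox Jacobian of an automorphism `ψ` of the free Lie
algebra, evaluated in a representation by 3 × 3 matrices over `K[t]`, has a left inverse
(`exists_jacobian_mul_eq_one`), so its determinant as a block matrix is a unit of `K[t]`, a
constant. If `ψ` induces `ω`, the Jacobian is `1 + t² N`, with determinant `1 + t² tr N` modulo
`t⁴`; hence `tr N` has no term of degree one (`coeff_one_trace_eq_zero`).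

The representation sends `x₁` to `1` and `x₂, x₃, x₄` to `t` times matrix units forming a 3-cycle.
Every image is scalar modulo `t`, so commutators gain powers of `t`, and Fox derivatives of the
relation ideal lie in `t³` with trace in `t⁴` (`traceDvd_derivation_relIdeal`): they do not affect
the critical coefficient. The derivative of the added commutator by `x₁` closes the 3-cycle and
contributes `±t³` to the trace (`derivation_omegaTerm`), a contradiction.

For existence, the added word `w` lies in `L''`, and replacing `x₁` by `x₁ ± w` changes `w` only by
an element of `[L'', L'] = γ₃(L')`; so adding `w` and adding `-w` are inverse modulo the relations.
Uniqueness holds because the `y_i` generate. -/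

/-- A Lie subalgebra of the free Lie algebra containing the free generators is everything. -/
theorem mem_of_generators (S : LieSubalgebra K (FreeLieAlgebra K X))
    (h : ∀ i, FreeLieAlgebra.of K i ∈ S) (u : FreeLieAlgebra K X) : u ∈ S := by
  have key : S.incl.comp (FreeLieAlgebra.lift K fun i => (⟨FreeLieAlgebra.of K i, h i⟩ : S)) =
      LieHom.id := by
    ext i
    simp
  have hu := LieHom.congr_fun key u
  simp only [LieHom.comp_apply, LieSubalgebra.coe_incl, LieHom.coe_id, id_eq] at hu
  rw [← hu]
  exact SetLike.coe_mem _

/-- Induction over a linear predicate closed under brackets. -/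
theorem freeLie_induction {p : FreeLieAlgebra K X → Prop} (h0 : p 0)
    (hadd : ∀ a b, p a → p b → p (a + b)) (hsmul : ∀ (c : K) a, p a → p (c • a))
    (hlie : ∀ a b, p a → p b → p ⁅a, b⁆) (hof : ∀ i, p (FreeLieAlgebra.of K i))
    (u : FreeLieAlgebra K X) : p u :=
  mem_of_generators
    { carrier := {a | p a}
      zero_mem' := h0
      add_mem' := fun {a b} => hadd a b
      smul_mem' := hsmul
      lie_mem' := fun {a b} => hlie a b } hof u

/-- To show that the image of a product of ideals under a linear map satisfies a linear predicate,
check it on brackets. -/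
theorem lie_induction {L V : Type*} [LieRing L] [LieAlgebra K L] [AddCommGroup V] [Module K V]
    (f : L →ₗ[K] V) {I J : LieIdeal K L} {p : V → Prop} (h0 : p 0)
    (hadd : ∀ {a b}, p a → p b → p (a + b)) (hsmul : ∀ (c : K) {a}, p a → p (c • a))
    (hlie : ∀ a ∈ I, ∀ b ∈ J, p (f ⁅a, b⁆)) {u : L} (hu : u ∈ ⁅I, J⁆) : p (f u) := by
  have hu' : u ∈ (⁅I, J⁆ : LieIdeal K L).toSubmodule := hu
  rw [LieSubmodule.lieIdeal_oper_eq_linear_span'] at hu'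
  refine Submodule.span_induction (p := fun v _ => p (f v)) ?_ ?_ ?_ ?_ hu'
  · rintro _ ⟨a, ha, b, hb, rfl⟩
    exact hlie a ha b hb
  · rwa [map_zero]
  · intro a b _ _ ha hb
    rw [map_add]
    exact hadd ha hb
  · intro c a _ ha
    rw [map_smul]
    exact hsmul c ha

variable {A : Type*} [Ring A] [Algebra K A]

/-- The crossed derivations of a Lie algebra along a representation in an associative algebra,
acting on the left. -/
def IsFoxDerivation {L : Type*} [LieRing L] [LieAlgebra K L] (ρ : L →ₗ⁅K⁆ A) (D : L →ₗ[K] A) :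
    Prop :=
  ∀ a b, D ⁅a, b⁆ = ρ a * D b - ρ b * D a

/-- `D` is a crossed derivation exactly when `u ↦ !![ρ u, D u; 0, 0]` is a Lie homomorphism, and
freeness allows any values on the generators. -/
theorem exists_isFoxDerivation (ρ : FreeLieAlgebra K X →ₗ⁅K⁆ A) (c : X → A) :
    ∃ D : FreeLieAlgebra K X →ₗ[K] A, IsFoxDerivation ρ D ∧
      ∀ i, D (FreeLieAlgebra.of K i) = c i := by
  let F : FreeLieAlgebra K X →ₗ⁅K⁆ Matrix (Fin 2) (Fin 2) A :=
    FreeLieAlgebra.lift K fun i => !![ρ (FreeLieAlgebra.of K i), c i; 0, 0]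
  have hF : ∀ u, F u 0 0 = ρ u ∧ F u 1 0 = 0 ∧ F u 1 1 = 0 := by
    refine freeLie_induction ?_ ?_ ?_ ?_ ?_
    · simp
    · rintro a b ⟨h1, h2, h3⟩ ⟨h4, h5, h6⟩
      simp [h1, h2, h3, h4, h5, h6]
    · rintro c a ⟨h1, h2, h3⟩
      simp [h1, h2, h3]
    · rintro a b ⟨h1, h2, h3⟩ ⟨h4, h5, h6⟩
      simp [h1, h2, h3, h4, h5, h6, LieRing.of_associative_ring_bracket, Matrix.mul_apply]
    · intro i
      simp [F]
  refine ⟨{ toFun := fun u => F u 0 1, map_add' := by simp, map_smul' := by simp }, ?_, ?_⟩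
  · intro a b
    simp [hF a, hF b, LieRing.of_associative_ring_bracket, Matrix.mul_apply]
  · intro i
    simp [F]

theorem IsFoxDerivation.ext {ρ : FreeLieAlgebra K X →ₗ⁅K⁆ A} {D D' : FreeLieAlgebra K X →ₗ[K] A}
    (hD : IsFoxDerivation ρ D) (hD' : IsFoxDerivation ρ D')
    (h : ∀ i, D (FreeLieAlgebra.of K i) = D' (FreeLieAlgebra.of K i)) : D = D' := by
  ext u
  refine freeLie_induction (p := fun u => D u = D' u) ?_ ?_ ?_ ?_ h u
  · simp
  · intro a b ha hb
    simp [ha, hb]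
  · intro c a ha
    simp [ha]
  · intro a b ha hb
    rw [hD, hD', ha, hb]

/-- The Jacobian matrix of an automorphism of a free Lie algebra of finite rank, evaluated at a
representation, has a left inverse. -/
theorem exists_jacobian_mul_eq_one [Fintype X] [DecidableEq X]
    (ψ : FreeLieAlgebra K X ≃ₗ⁅K⁆ FreeLieAlgebra K X)
    (ρ : FreeLieAlgebra K X →ₗ⁅K⁆ A) (D : X → FreeLieAlgebra K X →ₗ[K] A)
    (hD : ∀ k, IsFoxDerivation ρ (D k))
    (hDof : ∀ k i, D k (FreeLieAlgebra.of K i) = if i = k then 1 else 0) :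
    ∃ H : Matrix X X A,
      H * Matrix.of (fun j k => D k (ψ (FreeLieAlgebra.of K j))) = 1 := by
  choose E hE hEof using fun k : X => exists_isFoxDerivation
    (ρ.comp ψ.toLieHom) (fun i => if i = k then (1 : A) else 0)
  -- Chain rule: both sides are crossed derivations along `ρ ∘ ψ` with the same values on
  -- generators. Taking `u = ψ⁻¹(x_i)` then gives the left inverse.
  have key : ∀ k u, D k (ψ u) = ∑ j, E j u * D k (ψ (FreeLieAlgebra.of K j)) := by
    intro k u
    let T : FreeLieAlgebra K X →ₗ[K] A :=
      ∑ j, (LinearMap.mulRight K (D k (ψ (FreeLieAlgebra.of K j)))).comp (E j)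
    have hT : ∀ u, T u = ∑ j, E j u * D k (ψ (FreeLieAlgebra.of K j)) := by
      intro u
      simp [T]
    rw [← hT]
    refine LinearMap.congr_fun (f := (D k).comp (ψ.toLieHom : _ →ₗ[K] FreeLieAlgebra K X))
      (IsFoxDerivation.ext (ρ := ρ.comp ψ.toLieHom) ?_ ?_ ?_) u
    · intro a b
      have hψ : ψ ⁅a, b⁆ = ⁅ψ a, ψ b⁆ := ψ.toLieHom.map_lie a b
      have h := hD k (ψ a) (ψ b)
      rw [← hψ] at h
      simpa using h
    · intro a b
      have h := fun j => hE j a b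
      simp only [hT, h, Finset.mul_sum, ← Finset.sum_sub_distrib, sub_mul, mul_assoc]
    · intro i
      simp [hT, hEof]
  refine ⟨Matrix.of fun i j => E j (ψ.symm (FreeLieAlgebra.of K i)), ?_⟩
  ext i k
  rw [Matrix.mul_apply, Matrix.one_apply]
  simp only [Matrix.of_apply]
  rw [← key, LieEquiv.apply_symm_apply, hDof]

end FoxDerivations

/-! ### The determinant obstruction. -/

/-- A block matrix `1 + t² N` over `K[t]` with a left inverse has no term of degree one in the
trace of `N`. -/
theorem coeff_one_trace_eq_zero {K : Type*} [Field K] {ι κ : Type*} [Fintype ι] [DecidableEq ι]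
    [Fintype κ] [DecidableEq κ] (H N : Matrix ι ι (Matrix κ κ K[X]))
    (h : H * (1 + (X ^ 2 : K[X]) • N) = 1) : (∑ j, (N j j).trace).coeff 1 = 0 := by
  have h1 := congrArg (Matrix.compRingEquiv ι κ K[X]) h
  rw [map_mul, map_add, map_one] at h1
  have h2 : Matrix.compRingEquiv ι κ K[X] ((X ^ 2 : K[X]) • N) =
      (X ^ 2 : K[X]) • Matrix.compRingEquiv ι κ K[X] N := by
    ext ⟨i, a⟩ ⟨j, b⟩
    simp
  have h3 : (Matrix.compRingEquiv ι κ K[X] N).trace = ∑ j, (N j j).trace := by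
    simp [Matrix.trace, Fintype.sum_prod_type]
  rw [h2] at h1
  have h4 := congrArg Matrix.det h1
  rw [Matrix.det_mul, Matrix.det_one, Matrix.det_one_add_smul, h3] at h4
  obtain ⟨r, -, hr⟩ := Polynomial.isUnit_iff.1 (IsUnit.of_mul_eq_one_right _ h4)
  -- The remainder of `det (1 + t² N)` is a multiple of `(t²)² = t⁴`, so degree 3 sees only `t² tr
  -- N`.
  have h5 := congrArg (fun q : K[X] => q.coeff 3) hr
  rw [← pow_mul] at h5
  simpa [Polynomial.coeff_C, Polynomial.coeff_one, Polynomial.coeff_mul_X_pow'] using h5.symm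

/-! ### Orders in `t` under the test representation. -/

section Evaluation

attribute [local instance] LieRing.ofAssociativeRing

variable {K : Type*} [Field K] {n : ℕ}

/-- The values of the free generators in the test representation over `K[t]`. -/
noncomputable def testGen (K : Type*) [Field K] (n : ℕ) (i : Fin n) :
    Matrix (Fin 3) (Fin 3) K[X] :=
  if i.val = 0 then 1
  else if i.val = 1 then Matrix.single 0 1 X
  else if i.val = 2 then Matrix.single 1 2 X
  else if i.val = 3 then Matrix.single 2 0 X
  else 0

/-- The test representation of the free Lie algebra by matrices over `K[t]`. -/
noncomputable def testRep (K : Type*) [Field K] (n : ℕ) :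
    FreeLieAlgebra K (Fin n) →ₗ⁅K⁆ Matrix (Fin 3) (Fin 3) K[X] :=
  FreeLieAlgebra.lift K (testGen K n)

/-- Matrices which are scalar modulo `t`. -/
def ScalarModX (m : Matrix (Fin 3) (Fin 3) K[X]) : Prop :=
  ∃ (c : K[X]) (m' : Matrix (Fin 3) (Fin 3) K[X]), m = c • 1 + (X : K[X]) • m'

/-- Matrices divisible by `t ^ k`. -/
def DvdXPow (k : ℕ) (m : Matrix (Fin 3) (Fin 3) K[X]) : Prop :=
  ∃ m' : Matrix (Fin 3) (Fin 3) K[X], m = (X ^ k : K[X]) • m'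

/-- Matrices divisible by `t ^ k` whose trace is divisible by `t ^ (k + 1)`. -/
def TraceDvd (k : ℕ) (m : Matrix (Fin 3) (Fin 3) K[X]) : Prop :=
  ∃ m' : Matrix (Fin 3) (Fin 3) K[X], m = (X ^ k : K[X]) • m' ∧ (X : K[X]) ∣ m'.trace

theorem ScalarModX.zero : ScalarModX (0 : Matrix (Fin 3) (Fin 3) K[X]) := ⟨0, 0, by simp⟩

theorem ScalarModX.add {a b : Matrix (Fin 3) (Fin 3) K[X]} (ha : ScalarModX a)
    (hb : ScalarModX b) : ScalarModX (a + b) := by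
  obtain ⟨c, m, rfl⟩ := ha
  obtain ⟨d, m', rfl⟩ := hb
  exact ⟨c + d, m + m', by module⟩

theorem ScalarModX.smul (k : K) {a : Matrix (Fin 3) (Fin 3) K[X]} (ha : ScalarModX a) :
    ScalarModX (k • a) := by
  obtain ⟨c, m, rfl⟩ := ha
  exact ⟨k • c, k • m, by rw [smul_add, smul_assoc, smul_comm k (X : K[X]) m]⟩

theorem ScalarModX.sub {a b : Matrix (Fin 3) (Fin 3) K[X]} (ha : ScalarModX a)
    (hb : ScalarModX b) : ScalarModX (a - b) := by
  obtain ⟨c, m, rfl⟩ := ha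
  obtain ⟨d, m', rfl⟩ := hb
  exact ⟨c - d, m - m', by module⟩

theorem ScalarModX.mul {a b : Matrix (Fin 3) (Fin 3) K[X]} (ha : ScalarModX a)
    (hb : ScalarModX b) : ScalarModX (a * b) := by
  obtain ⟨c, m, rfl⟩ := ha
  obtain ⟨d, m', rfl⟩ := hb
  refine ⟨c * d, c • m' + d • m + (X : K[X]) • (m * m'), ?_⟩
  simp only [add_mul, mul_add, smul_mul_assoc, mul_smul_comm, one_mul, mul_one]
  module

theorem DvdXPow.zero (k : ℕ) : DvdXPow k (0 : Matrix (Fin 3) (Fin 3) K[X]) := ⟨0, by simp⟩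

theorem DvdXPow.add {k : ℕ} {a b : Matrix (Fin 3) (Fin 3) K[X]} (ha : DvdXPow k a)
    (hb : DvdXPow k b) : DvdXPow k (a + b) := by
  obtain ⟨m, rfl⟩ := ha
  obtain ⟨m', rfl⟩ := hb
  exact ⟨m + m', by rw [smul_add]⟩

theorem DvdXPow.smul {k : ℕ} (c : K) {a : Matrix (Fin 3) (Fin 3) K[X]} (ha : DvdXPow k a) :
    DvdXPow k (c • a) := by
  obtain ⟨m, rfl⟩ := ha
  exact ⟨c • m, by rw [smul_comm]⟩

theorem TraceDvd.zero (k : ℕ) : TraceDvd k (0 : Matrix (Fin 3) (Fin 3) K[X]) :=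
  ⟨0, by simp⟩

theorem TraceDvd.add {k : ℕ} {a b : Matrix (Fin 3) (Fin 3) K[X]} (ha : TraceDvd k a)
    (hb : TraceDvd k b) : TraceDvd k (a + b) := by
  obtain ⟨m, rfl, hm⟩ := ha
  obtain ⟨m', rfl, hm'⟩ := hb
  exact ⟨m + m', by rw [smul_add], by rw [trace_add]; exact dvd_add hm hm'⟩

theorem TraceDvd.smul {k : ℕ} (c : K) {a : Matrix (Fin 3) (Fin 3) K[X]} (ha : TraceDvd k a) :
    TraceDvd k (c • a) := by
  obtain ⟨m, rfl, hm⟩ := ha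
  exact ⟨c • m, by rw [smul_comm], by rw [trace_smul, smul_eq_C_mul]; exact hm.mul_left _⟩

theorem TraceDvd.sub {k : ℕ} {a b : Matrix (Fin 3) (Fin 3) K[X]} (ha : TraceDvd k a)
    (hb : TraceDvd k b) : TraceDvd k (a - b) := by
  obtain ⟨m, rfl, hm⟩ := ha
  obtain ⟨m', rfl, hm'⟩ := hb
  exact ⟨m - m', by rw [smul_sub], by rw [trace_sub]; exact dvd_sub hm hm'⟩

theorem TraceDvd.mul_scalarModX {k : ℕ} {a b : Matrix (Fin 3) (Fin 3) K[X]} (ha : TraceDvd k a)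
    (hb : ScalarModX b) : TraceDvd k (a * b) := by
  obtain ⟨m, rfl, hm⟩ := ha
  obtain ⟨c, m', rfl⟩ := hb
  refine ⟨c • m + (X : K[X]) • (m * m'), ?_, ?_⟩
  · simp only [mul_add, smul_mul_assoc, mul_smul_comm, mul_one]
    module
  · rw [trace_add, trace_smul, trace_smul]
    exact dvd_add (hm.mul_left _) (dvd_mul_right _ _)

theorem TraceDvd.of_dvdXPow {k : ℕ} {a : Matrix (Fin 3) (Fin 3) K[X]} (ha : DvdXPow (k + 1) a) :
    TraceDvd k a := by
  obtain ⟨m, rfl⟩ := ha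
  exact ⟨(X : K[X]) • m, by rw [smul_smul, pow_succ], by
    rw [trace_smul]; exact dvd_mul_right _ _⟩

theorem DvdXPow.mul {k l : ℕ} {a b : Matrix (Fin 3) (Fin 3) K[X]} (ha : DvdXPow k a)
    (hb : DvdXPow l b) : DvdXPow (k + l) (a * b) := by
  obtain ⟨m, rfl⟩ := ha
  obtain ⟨m', rfl⟩ := hb
  exact ⟨m * m', by rw [smul_mul_assoc, mul_smul_comm, smul_smul, pow_add]⟩

theorem DvdXPow.mul_right {k : ℕ} {a : Matrix (Fin 3) (Fin 3) K[X]} (ha : DvdXPow k a)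
    (b : Matrix (Fin 3) (Fin 3) K[X]) : DvdXPow k (a * b) :=
  ha.mul (l := 0) ⟨b, by simp⟩

theorem DvdXPow.sub {k : ℕ} {a b : Matrix (Fin 3) (Fin 3) K[X]} (ha : DvdXPow k a)
    (hb : DvdXPow k b) : DvdXPow k (a - b) := by
  obtain ⟨m, rfl⟩ := ha
  obtain ⟨m', rfl⟩ := hb
  exact ⟨m - m', by rw [smul_sub]⟩

/-- Commuting with a matrix scalar modulo `t` raises the order and kills the trace. -/
theorem DvdXPow.commutator {k : ℕ} {a b : Matrix (Fin 3) (Fin 3) K[X]} (ha : DvdXPow k a)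
    (hb : ScalarModX b) : DvdXPow (k + 1) ⁅a, b⁆ ∧ ⁅a, b⁆.trace = 0 := by
  obtain ⟨m, rfl⟩ := ha
  obtain ⟨c, m', rfl⟩ := hb
  constructor
  · refine ⟨m * m' - m' * m, ?_⟩
    simp only [LieRing.of_associative_ring_bracket, mul_add, add_mul, smul_mul_assoc,
      mul_smul_comm, mul_one, one_mul]
    module
  · rw [LieRing.of_associative_ring_bracket, trace_sub, trace_mul_comm, sub_self]

theorem single_scalarModX (i j : Fin 3) :
    ScalarModX (Matrix.single i j (X : K[X])) :=
  ⟨0, Matrix.single i j 1, by simp⟩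

theorem scalarModX_testRep (u : FreeLieAlgebra K (Fin n)) : ScalarModX (testRep K n u) := by
  refine freeLie_induction (p := fun u => ScalarModX (testRep K n u)) ?_ ?_ ?_ ?_ ?_ u
  · simpa using ScalarModX.zero
  · intro a b ha hb
    simpa using ha.add hb
  · intro c a ha
    simpa using ha.smul c
  · intro a b ha hb
    rw [LieHom.map_lie, LieRing.of_associative_ring_bracket]
    exact (ha.mul hb).sub (hb.mul ha)
  · intro i
    rw [testRep, FreeLieAlgebra.lift_of_apply, testGen]
    split_ifs
    · exact ⟨1, 0, by simp⟩
    all_goals first | exact single_scalarModX _ _ | exact ScalarModX.zero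

theorem dvdXPow_two_testRep {u : FreeLieAlgebra K (Fin n)}
    (hu : u ∈ derivedIdeal (⊤ : LieIdeal K (FreeLieAlgebra K (Fin n)))) :
    DvdXPow 2 (testRep K n u) := by
  refine lie_induction (p := DvdXPow 2)
    (testRep K n : _ →ₗ[K] Matrix (Fin 3) (Fin 3) K[X]) (.zero 2) .add .smul ?_ hu
  intro a _ b _
  obtain ⟨c, m, hc⟩ := scalarModX_testRep a
  obtain ⟨d, m', hd⟩ := scalarModX_testRep b
  refine ⟨m * m' - m' * m, ?_⟩
  rw [LieHom.coe_toLinearMap, LieHom.map_lie, hc, hd, LieRing.of_associative_ring_bracket]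
  simp only [mul_add, add_mul, smul_mul_assoc, mul_smul_comm, mul_one, one_mul]
  module

/-- The image of `[a, b]` is a matrix commutator, so its trace vanishes, and `t³` cancels from it
because `K[t]` is a domain. -/
theorem traceDvd_testRep {u : FreeLieAlgebra K (Fin n)}
    (hu : u ∈ gammaThree (⊤ : LieIdeal K (FreeLieAlgebra K (Fin n)))) :
    TraceDvd 3 (testRep K n u) := by
  refine lie_induction (p := TraceDvd 3)
    (testRep K n : _ →ₗ[K] Matrix (Fin 3) (Fin 3) K[X]) (.zero 3) .add .smul ?_ hu
  intro a ha b _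
  rw [LieHom.coe_toLinearMap, LieHom.map_lie]
  obtain ⟨⟨m, hm⟩, h⟩ := DvdXPow.commutator (dvdXPow_two_testRep ha) (scalarModX_testRep b)
  refine ⟨m, hm, ?_⟩
  rw [hm, trace_smul, smul_eq_mul] at h
  simp [(mul_eq_zero.1 h).resolve_left (pow_ne_zero _ X_ne_zero)]

variable {D : FreeLieAlgebra K (Fin n) →ₗ[K] Matrix (Fin 3) (Fin 3) K[X]}

theorem scalarModX_derivation (hD : IsFoxDerivation (testRep K n) D)
    (h : ∀ i, ScalarModX (D (FreeLieAlgebra.of K i))) (u : FreeLieAlgebra K (Fin n)) :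
    ScalarModX (D u) := by
  refine freeLie_induction (p := fun u => ScalarModX (D u)) ?_ ?_ ?_ ?_ h u
  · simpa using ScalarModX.zero
  · intro a b ha hb
    simpa using ha.add hb
  · intro c a ha
    simpa using ha.smul c
  · intro a b ha hb
    rw [hD]
    exact ((scalarModX_testRep a).mul hb).sub ((scalarModX_testRep b).mul ha)

theorem dvdXPow_derivation_lie (hD : IsFoxDerivation (testRep K n) D)
    {a b : FreeLieAlgebra K (Fin n)}
    (ha : a ∈ derivedIdeal (⊤ : LieIdeal K (FreeLieAlgebra K (Fin n))))
    (hb : b ∈ derivedIdeal (⊤ : LieIdeal K (FreeLieAlgebra K (Fin n)))) :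
    DvdXPow 2 (D ⁅a, b⁆) := by
  rw [hD]
  exact ((dvdXPow_two_testRep ha).mul_right _).sub ((dvdXPow_two_testRep hb).mul_right _)

/-- On the relation ideal the Fox derivatives vanish to order three in the test
representation, with trace vanishing to order four. -/
theorem traceDvd_derivation_relIdeal (hD : IsFoxDerivation (testRep K n) D)
    (h : ∀ i, ScalarModX (D (FreeLieAlgebra.of K i))) {u : FreeLieAlgebra K (Fin n)}
    (hu : u ∈ relIdeal K (FreeLieAlgebra K (Fin n))) : TraceDvd 3 (D u) := by
  obtain ⟨v, hv, w, hw, rfl⟩ := LieSubmodule.mem_sup _ _ _ |>.1 hu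
  rw [map_add]
  refine TraceDvd.add ?_ ?_
  -- On `γ₃(L') = [L'', L']` both terms of the product rule have order 4, so the trace condition is
  -- automatic.
  · refine lie_induction (p := TraceDvd 3) D (.zero 3) .add .smul ?_ hv
    intro a ha b hb
    have h2 : DvdXPow 2 (D a) := by
      refine lie_induction (p := DvdXPow 2) D (.zero 2) .add .smul ?_ ha
      intro a ha b hb
      exact dvdXPow_derivation_lie hD ha hb
    have ha' : DvdXPow 4 (testRep K n a) := by
      refine lie_induction (p := DvdXPow 4)
          (testRep K n : _ →ₗ[K] Matrix (Fin 3) (Fin 3) K[X]) (.zero 4) .add .smul ?_ ha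
      intro a ha b hb
      rw [LieHom.coe_toLinearMap, LieHom.map_lie, LieRing.of_associative_ring_bracket]
      exact ((dvdXPow_two_testRep ha).mul (dvdXPow_two_testRep hb)).sub
        ((dvdXPow_two_testRep hb).mul (dvdXPow_two_testRep ha))
    rw [hD]
    have hb2 : DvdXPow 2 (testRep K n b) := dvdXPow_two_testRep hb
    have hb4 : DvdXPow 4 (testRep K n b * D a) := DvdXPow.mul (k := 2) (l := 2) hb2 h2
    have ha4 : DvdXPow 4 (testRep K n a * D b) := ha'.mul_right (D b)
    exact TraceDvd.of_dvdXPow (k := 3) (ha4.sub hb4)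
  -- On `(γ₃(L))'` the order is only 3; the trace condition survives because the derivatives are
  -- scalar modulo `t`.
  · refine lie_induction (p := TraceDvd 3) D (.zero 3) .add .smul ?_ hw
    intro a ha b hb
    rw [hD]
    exact ((traceDvd_testRep ha).mul_scalarModX (scalarModX_derivation hD h b)).sub
      ((traceDvd_testRep hb).mul_scalarModX (scalarModX_derivation hD h a))

end Evaluation

/-! ### The added commutator has a nonzero trace term. -/

section NonTame

attribute [local instance] LieRing.ofAssociativeRing

variable {K : Type*} [Field K] {n : ℕ}

/-- The element `[a, b, a, …, a, [c, d]]` with `m` extra copies of `a`. -/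
def omegaTerm {L : Type*} [LieRing L] (a b c d : L) (m : ℕ) : L :=
  ⁅repeatedLie ⁅a, b⁆ a m, ⁅c, d⁆⁆

theorem repeatedLie_mem {L : Type*} [LieRing L] [LieAlgebra K L] (I : LieIdeal K L) {a : L}
    (ha : a ∈ I) (b : L) (m : ℕ) : repeatedLie a b m ∈ I := by
  induction m with
  | zero => exact ha
  | succ m ih => exact lie_mem_left K L I _ _ ih

theorem lie_mem_derivedIdeal {L : Type*} [LieRing L] [LieAlgebra K L] (a b : L) :
    ⁅a, b⁆ ∈ derivedIdeal (⊤ : LieIdeal K L) :=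
  LieSubmodule.lie_mem_lie (LieSubmodule.mem_top _) (LieSubmodule.mem_top _)

variable {D : FreeLieAlgebra K (Fin n) →ₗ[K] Matrix (Fin 3) (Fin 3) K[X]}

theorem testRep_of (i : Fin n) : testRep K n (FreeLieAlgebra.of K i) = testGen K n i :=
  FreeLieAlgebra.lift_of_apply _ _

/-- The first generator maps to the identity, which is central. -/
theorem testRep_repeatedLie (hn : 4 ≤ n) (b : FreeLieAlgebra K (Fin n)) (m : ℕ) :
    testRep K n (repeatedLie ⁅FreeLieAlgebra.of K (Fin.castLE hn 0), b⁆
      (FreeLieAlgebra.of K (Fin.castLE hn 0)) m) = 0 := by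
  have h0 : testRep K n (FreeLieAlgebra.of K (Fin.castLE hn 0)) = 1 := by
    rw [testRep_of]
    simp [testGen]
  cases m <;>
  simp [repeatedLie, h0, LieRing.of_associative_ring_bracket]

theorem derivation_repeatedLie (hn : 4 ≤ n) (hD : IsFoxDerivation (testRep K n) D)
    (hD0 : D (FreeLieAlgebra.of K (Fin.castLE hn 0)) = 1)
    (hD1 : D (FreeLieAlgebra.of K (Fin.castLE hn 1)) = 0) (m : ℕ) :
    D (repeatedLie ⁅FreeLieAlgebra.of K (Fin.castLE hn 0), FreeLieAlgebra.of K (Fin.castLE hn 1)⁆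
      (FreeLieAlgebra.of K (Fin.castLE hn 0)) m) =
        ((-1) ^ (m + 1) : K[X]) • Matrix.single 0 1 (X : K[X]) := by
  induction m with
  | zero =>
    rw [repeatedLie, hD, hD0, hD1, testRep_of, testRep_of]
    simp [testGen, -Matrix.smul_single]
  | succ m ih =>
    rw [repeatedLie, hD, testRep_repeatedLie, ih, testRep_of]
    simp [testGen, pow_succ, -Matrix.smul_single]

/-- Only `-ρ([x₃, x₄]) D(r)` survives, `r` being the left factor, and `E₁₂E₂₀E₀₁ = E₁₁` closes the
cycle. -/
theorem derivation_omegaTerm (hn : 4 ≤ n) (hD : IsFoxDerivation (testRep K n) D)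
    (hD0 : D (FreeLieAlgebra.of K (Fin.castLE hn 0)) = 1)
    (hD1 : D (FreeLieAlgebra.of K (Fin.castLE hn 1)) = 0) (m : ℕ) :
    D (omegaTerm (FreeLieAlgebra.of K (Fin.castLE hn 0)) (FreeLieAlgebra.of K (Fin.castLE hn 1))
      (FreeLieAlgebra.of K (Fin.castLE hn 2)) (FreeLieAlgebra.of K (Fin.castLE hn 3)) m) =
        (X ^ 2 : K[X]) • Matrix.single 1 1 ((-1) ^ m * X : K[X]) := by
  rw [omegaTerm, hD, testRep_repeatedLie, derivation_repeatedLie hn hD hD0 hD1, LieHom.map_lie,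
    testRep_of, testRep_of, LieRing.of_associative_ring_bracket]
  simp [testGen, pow_succ, mul_comm, mul_left_comm]

theorem dvdXPow_derivation_omegaTerm (hD : IsFoxDerivation (testRep K n) D)
    (a b c d : FreeLieAlgebra K (Fin n)) (m : ℕ) : DvdXPow 2 (D (omegaTerm a b c d m)) :=
  dvdXPow_derivation_lie hD (repeatedLie_mem _ (lie_mem_derivedIdeal _ _) _ _)
    (lie_mem_derivedIdeal _ _)

/-- No automorphism of the free Lie algebra agrees modulo the relation ideal with the map which
adds `[x₁, x₂, x₁, …, x₁, [x₃, x₄]]` to `x₁` and fixes the other generators. -/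
theorem not_lifts_omega (hn : 4 ≤ n) (m : ℕ)
    (ψ : FreeLieAlgebra K (Fin n) ≃ₗ⁅K⁆ FreeLieAlgebra K (Fin n))
    (h0 : ψ (FreeLieAlgebra.of K (Fin.castLE hn 0)) - (FreeLieAlgebra.of K (Fin.castLE hn 0) +
      omegaTerm (FreeLieAlgebra.of K (Fin.castLE hn 0)) (FreeLieAlgebra.of K (Fin.castLE hn 1))
      (FreeLieAlgebra.of K (Fin.castLE hn 2)) (FreeLieAlgebra.of K (Fin.castLE hn 3)) m) ∈
        relIdeal K (FreeLieAlgebra K (Fin n)))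
    (h1 : ∀ j, j ≠ Fin.castLE hn 0 → ψ (FreeLieAlgebra.of K j) - FreeLieAlgebra.of K j ∈
        relIdeal K (FreeLieAlgebra K (Fin n))) : False := by
  choose D hD hDof using fun k : Fin n => exists_isFoxDerivation
    (testRep K n) (fun i => if i = k then (1 : Matrix (Fin 3) (Fin 3) K[X]) else 0)
  have hscal : ∀ k i, ScalarModX (D k (FreeLieAlgebra.of K i)) := by
    intro k i
    rw [hDof]
    split_ifs
    · exact ⟨1, 0, by simp⟩
    · exact .zero
  obtain ⟨H, hH⟩ := exists_jacobian_mul_eq_one ψ (testRep K n) D hD hDof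
  set v := omegaTerm (FreeLieAlgebra.of K (Fin.castLE hn 0)) (FreeLieAlgebra.of K (Fin.castLE hn 1))
      (FreeLieAlgebra.of K (Fin.castLE hn 2)) (FreeLieAlgebra.of K (Fin.castLE hn 3)) m with hv
  have hne : (Fin.castLE hn 1) ≠ Fin.castLE hn 0 := by
    simp [Fin.ext_iff]
  -- The word changes only the first row of the Jacobian, so its exact derivative is needed only on
  -- the diagonal; elsewhere order 2 suffices.
  have hV : ∀ k, ∃ V, D k v = (X ^ 2 : K[X]) • V ∧
      (k = Fin.castLE hn 0 → V = Matrix.single 1 1 ((-1) ^ m * X : K[X])) := by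
    intro k
    by_cases hk : k = Fin.castLE hn 0
    · refine ⟨_, derivation_omegaTerm hn (hD k) ?_ ?_ m, fun _ => rfl⟩
      · rw [hDof, if_pos hk.symm]
      · rw [hDof, if_neg (hk ▸ hne)]
    · obtain ⟨V, hV⟩ := dvdXPow_derivation_omegaTerm (hD k) _ _ _ _ m
      exact ⟨V, hV, fun h => absurd h hk⟩
  choose V hV hV0 using hV
  have hu : ∀ j, ψ (FreeLieAlgebra.of K j) - (FreeLieAlgebra.of K j +
      if j = Fin.castLE hn 0 then v else 0) ∈ relIdeal K (FreeLieAlgebra K (Fin n)) := by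
    intro j
    split_ifs with hj
    · rw [hj]
      exact h0
    · rw [add_zero]
      exact h1 j hj
  choose U hU hUt using fun j k => traceDvd_derivation_relIdeal (hD k) (hscal k) (hu j)
  let N : Matrix (Fin n) (Fin n) (Matrix (Fin 3) (Fin 3) K[X]) := Matrix.of fun j k =>
    (if j = Fin.castLE hn 0 then V k else 0) + (X : K[X]) • U j k
  have hJ : Matrix.of (fun j k => D k (ψ (FreeLieAlgebra.of K j))) = 1 + (X ^ 2 : K[X]) • N := by
    ext1 j k
    have h := hU j k
    rw [map_sub, map_add, sub_eq_iff_eq_add, hDof] at h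
    rw [Matrix.of_apply, h, Matrix.add_apply, Matrix.one_apply, Matrix.smul_apply]
    simp only [N, Matrix.of_apply, smul_add, smul_smul]
    split_ifs <;> simp only [hV, map_zero, smul_zero] <;> module
  rw [hJ] at hH
  have hc := coeff_one_trace_eq_zero H N hH
  have hN : ∀ j, (N j j).trace.coeff 1 = if j = Fin.castLE hn 0 then (-1) ^ m else 0 := by
    intro j
    obtain ⟨q, hq⟩ := hUt j j
    simp only [N, Matrix.of_apply, trace_add, trace_smul, hq, smul_eq_mul, coeff_add]
    -- One factor `X` is left from order 3 after extracting `t²`, the other from the trace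
    -- condition.
    have h2 : (X * (X * q)).coeff 1 = 0 :=
      (coeff_X_mul _ 0).trans (by simp)
    rw [h2, add_zero]
    split_ifs with hj
    · rw [hV0 j hj, trace_single_eq_same]
      have h3 : ((-1) ^ m * X : K[X]) = C ((-1) ^ m) * X := by simp
      rw [h3, coeff_C_mul, coeff_X_one, mul_one]
    · simp
  rw [Polynomial.finsetSum_coeff, Finset.sum_congr rfl fun j _ => hN j,
    Finset.sum_ite_eq' Finset.univ, if_pos (Finset.mem_univ _)] at hc
  exact pow_ne_zero m (neg_ne_zero.2 one_ne_zero) hc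

end NonTame

/-! ### Construction of the automorphism of the quotient. -/

section Automorphism

variable {K : Type*} [Field K]

theorem map_mem_lie {L M : Type*} [LieRing L] [LieAlgebra K L] [LieRing M] [LieAlgebra K M]
    (f : L →ₗ⁅K⁆ M) {I J : LieIdeal K L} {I' J' : LieIdeal K M} (hI : ∀ x ∈ I, f x ∈ I')
    (hJ : ∀ x ∈ J, f x ∈ J') {u : L} (hu : u ∈ ⁅I, J⁆) : f u ∈ (⁅I', J'⁆ : LieIdeal K M) := by
  refine lie_induction (p := fun x => x ∈ (⁅I', J'⁆ : LieIdeal K M)) (f : L →ₗ[K] M)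
    (zero_mem _) add_mem (fun c _ h => (⁅I', J'⁆ : LieIdeal K M).smul_mem c h) ?_ hu
  intro a ha b hb
  rw [LieHom.coe_toLinearMap, LieHom.map_lie]
  exact LieSubmodule.lie_mem_lie (hI a ha) (hJ b hb)

theorem map_mem_relIdeal {L M : Type*} [LieRing L] [LieAlgebra K L] [LieRing M] [LieAlgebra K M]
    (f : L →ₗ⁅K⁆ M) {u : L} (hu : u ∈ relIdeal K L) : f u ∈ relIdeal K M := by
  have htop : ∀ x ∈ (⊤ : LieIdeal K L), f x ∈ (⊤ : LieIdeal K M) := fun x _ =>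
    LieSubmodule.mem_top _
  have hder : ∀ x ∈ derivedIdeal (⊤ : LieIdeal K L), f x ∈ derivedIdeal (⊤ : LieIdeal K M) :=
    fun x hx => map_mem_lie f htop htop hx
  have hgam : ∀ x ∈ gammaThree (⊤ : LieIdeal K L), f x ∈ gammaThree (⊤ : LieIdeal K M) :=
    fun x hx => map_mem_lie f hder htop hx
  obtain ⟨v, hv, w, hw, rfl⟩ := LieSubmodule.mem_sup _ _ _ |>.1 hu
  rw [map_add]
  exact add_mem
    ((le_sup_left : gammaThree (derivedIdeal (⊤ : LieIdeal K M)) ≤ relIdeal K M)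
      (map_mem_lie f (fun x hx => map_mem_lie f hder hder hx) hder hv))
    ((le_sup_right : derivedIdeal (gammaThree (⊤ : LieIdeal K M)) ≤ relIdeal K M)
      (map_mem_lie f hgam hgam hw))

theorem lie_mem_relIdeal {L : Type*} [LieRing L] [LieAlgebra K L] {a b : L}
    (ha : a ∈ derivedIdeal (derivedIdeal (⊤ : LieIdeal K L)))
    (hb : b ∈ derivedIdeal (⊤ : LieIdeal K L)) : ⁅a, b⁆ ∈ relIdeal K L :=
  (le_sup_left : gammaThree (derivedIdeal (⊤ : LieIdeal K L)) ≤ relIdeal K L)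
    (LieSubmodule.lie_mem_lie ha hb)

theorem omegaTerm_mem {L : Type*} [LieRing L] [LieAlgebra K L] (a b c d : L) (m : ℕ) :
    omegaTerm a b c d m ∈ derivedIdeal (derivedIdeal (⊤ : LieIdeal K L)) :=
  LieSubmodule.lie_mem_lie (repeatedLie_mem _ (lie_mem_derivedIdeal _ _) _ _)
    (lie_mem_derivedIdeal _ _)

/-- Changing the first entry by an element of the second derived algebra does not change
`[a, b, a, …, a, [c, d]]` modulo the relation ideal. -/
theorem omegaTerm_add_sub_mem {L : Type*} [LieRing L] [LieAlgebra K L] {w : L}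
    (hw : w ∈ derivedIdeal (derivedIdeal (⊤ : LieIdeal K L))) (a b c d : L) (m : ℕ) :
    omegaTerm (a + w) b c d m - omegaTerm a b c d m ∈ relIdeal K L := by
  rw [omegaTerm, omegaTerm, ← sub_lie]
  refine lie_mem_relIdeal ?_ (lie_mem_derivedIdeal _ _)
  induction m with
  | zero =>
    rw [repeatedLie, repeatedLie, add_lie, add_sub_cancel_left]
    exact lie_mem_left K L _ _ _ hw
  | succ m ih =>
    have h : repeatedLie ⁅a + w, b⁆ (a + w) (m + 1) - repeatedLie ⁅a, b⁆ a (m + 1) =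
        ⁅repeatedLie ⁅a + w, b⁆ (a + w) m - repeatedLie ⁅a, b⁆ a m, a⁆ +
          ⁅repeatedLie ⁅a + w, b⁆ (a + w) m, w⁆ := by
      simp only [repeatedLie, sub_lie, lie_add]
      abel
    rw [h]
    exact add_mem (lie_mem_left K L _ _ _ ih) (lie_mem_right K L _ _ _ hw)

theorem map_omegaTerm {L M : Type*} [LieRing L] [LieAlgebra K L] [LieRing M] [LieAlgebra K M]
    (f : L →ₗ⁅K⁆ M) (a b c d : L) (m : ℕ) :
    f (omegaTerm a b c d m) = omegaTerm (f a) (f b) (f c) (f d) m := by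
  have h : f (repeatedLie ⁅a, b⁆ a m) = repeatedLie ⁅f a, f b⁆ (f a) m := by
    induction m with
    | zero => simp [repeatedLie]
    | succ m ih => rw [repeatedLie, LieHom.map_lie, ih, repeatedLie]
  rw [omegaTerm, omegaTerm, LieHom.map_lie, LieHom.map_lie, h]

variable {n : ℕ}

/-- The projection of the free Lie algebra onto the relatively free one. -/
noncomputable def relProj (K : Type*) [Field K] (n : ℕ) :
    FreeLieAlgebra K (Fin n) →ₗ⁅K⁆ RelFree K n where
  toFun := LieSubmodule.Quotient.mk
  map_add' _ _ := rfl
  map_smul' _ _ := rfl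
  map_lie' := rfl

theorem relProj_surjective : Function.Surjective (relProj K n) :=
  LieSubmodule.Quotient.surjective_mk' _

theorem relProj_eq_iff {u v : FreeLieAlgebra K (Fin n)} :
    relProj K n u = relProj K n v ↔ u - v ∈ relIdeal K (FreeLieAlgebra K (Fin n)) :=
  Submodule.Quotient.eq (relIdeal K (FreeLieAlgebra K (Fin n))).toSubmodule

/-- Homomorphisms from the relatively free Lie algebra are determined by the generators. -/
theorem relFree_hom_ext {M : Type*} [LieRing M] [LieAlgebra K M] {f g : RelFree K n →ₗ⁅K⁆ M}
    (h : ∀ i, f (gen K i) = g (gen K i)) : f = g := by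
  have hfg : f.comp (relProj K n) = g.comp (relProj K n) := FreeLieAlgebra.hom_ext h
  ext r
  obtain ⟨u, rfl⟩ := relProj_surjective r
  exact LieHom.congr_fun hfg u

/-- The endomorphism of the relatively free Lie algebra induced by one of the free Lie algebra. -/
noncomputable def relMap (f : FreeLieAlgebra K (Fin n) →ₗ⁅K⁆ FreeLieAlgebra K (Fin n)) :
    RelFree K n →ₗ⁅K⁆ RelFree K n :=
  { Submodule.mapQ (relIdeal K (FreeLieAlgebra K (Fin n))).toSubmodule
      (relIdeal K (FreeLieAlgebra K (Fin n))).toSubmodule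
      (f : FreeLieAlgebra K (Fin n) →ₗ[K] FreeLieAlgebra K (Fin n))
      (fun u (hu : u ∈ relIdeal K (FreeLieAlgebra K (Fin n))) => map_mem_relIdeal f hu) with
    map_lie' := by
      intro r s
      obtain ⟨u, rfl⟩ := relProj_surjective r
      obtain ⟨v, rfl⟩ := relProj_surjective s
      exact congrArg (relProj K n) (f.map_lie u v) }

theorem relMap_relProj (f : FreeLieAlgebra K (Fin n) →ₗ⁅K⁆ FreeLieAlgebra K (Fin n))
    (u : FreeLieAlgebra K (Fin n)) : relMap f (relProj K n u) = relProj K n (f u) :=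
  rfl

theorem relMap_gen (f : FreeLieAlgebra K (Fin n) →ₗ⁅K⁆ FreeLieAlgebra K (Fin n)) (i : Fin n) :
    relMap f (gen K i) = relProj K n (f (FreeLieAlgebra.of K i)) :=
  rfl

/-- The term of the free Lie algebra by which `ω` changes the first generator. -/
noncomputable def omegaWord (K : Type*) [Field K] (hn : 4 ≤ n) (m : ℕ) :
    FreeLieAlgebra K (Fin n) :=
  omegaTerm (FreeLieAlgebra.of K (Fin.castLE hn 0)) (FreeLieAlgebra.of K (Fin.castLE hn 1))
    (FreeLieAlgebra.of K (Fin.castLE hn 2)) (FreeLieAlgebra.of K (Fin.castLE hn 3)) m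

/-- The endomorphism of the free Lie algebra adding `w` to the first generator. -/
noncomputable def transvection (hn : 4 ≤ n) (w : FreeLieAlgebra K (Fin n)) :
    FreeLieAlgebra K (Fin n) →ₗ⁅K⁆ FreeLieAlgebra K (Fin n) :=
  FreeLieAlgebra.lift K fun i =>
    FreeLieAlgebra.of K i + if i = Fin.castLE hn 0 then w else 0

theorem transvection_of (hn : 4 ≤ n) (w : FreeLieAlgebra K (Fin n)) (i : Fin n) :
    transvection hn w (FreeLieAlgebra.of K i) =
      FreeLieAlgebra.of K i + if i = Fin.castLE hn 0 then w else 0 :=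
  FreeLieAlgebra.lift_of_apply _ _

theorem relProj_transvection_omegaWord (hn : 4 ≤ n) (m : ℕ) {w : FreeLieAlgebra K (Fin n)}
    (hw : w ∈ derivedIdeal (derivedIdeal (⊤ : LieIdeal K (FreeLieAlgebra K (Fin n))))) :
    relProj K n (transvection hn w (omegaWord K hn m)) = relProj K n (omegaWord K hn m) := by
  rw [relProj_eq_iff, omegaWord, map_omegaTerm, transvection_of, transvection_of,
    transvection_of, transvection_of, if_pos rfl, if_neg (by simp [Fin.ext_iff]),
    if_neg (by simp [Fin.ext_iff]), if_neg (by simp [Fin.ext_iff]), add_zero, add_zero, add_zero]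
  exact omegaTerm_add_sub_mem hw _ _ _ _ _

/-- The composite sends `y₁` to `y₁` plus the sum assumed to vanish. -/
theorem relMap_transvection_comp (hn : 4 ≤ n) {v w : FreeLieAlgebra K (Fin n)}
    (hvw : relProj K n (transvection hn w v) + relProj K n w = 0) :
    (relMap (transvection hn w)).comp (relMap (transvection hn v)) = LieHom.id := by
  refine relFree_hom_ext fun i => ?_
  rw [LieHom.comp_apply, relMap_gen, relMap_relProj, transvection_of, map_add, transvection_of]
  split_ifs with hi
  · rw [map_add, map_add, add_assoc, add_comm (relProj K n w), hvw, add_zero]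
    rfl
  · rw [add_zero, map_zero, add_zero]
    rfl

/-- The automorphism of the relatively free Lie algebra with the defining values of `ω`. -/
noncomputable def omega (K : Type*) [Field K] (hn : 4 ≤ n) (m : ℕ) :
    RelFree K n ≃ₗ⁅K⁆ RelFree K n :=
  have hv : omegaWord K hn m ∈
      derivedIdeal (derivedIdeal (⊤ : LieIdeal K (FreeLieAlgebra K (Fin n)))) :=
    omegaTerm_mem _ _ _ _ _
  { relMap (transvection hn (omegaWord K hn m)) with
    invFun := relMap (transvection hn (-omegaWord K hn m))
    left_inv := LieHom.congr_fun (relMap_transvection_comp hn (by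
      rw [relProj_transvection_omegaWord hn m (neg_mem hv), map_neg, add_neg_cancel]))
    right_inv := LieHom.congr_fun (relMap_transvection_comp hn (by
      rw [map_neg, map_neg, relProj_transvection_omegaWord hn m hv, neg_add_cancel])) }

theorem relProj_omegaWord (hn : 4 ≤ n) (m : ℕ) :
    relProj K n (omegaWord K hn m) =
      ⁅repeatedLie ⁅gen K (Fin.castLE hn 0), gen K (Fin.castLE hn 1)⁆
      (gen K (Fin.castLE hn 0)) m, ⁅gen K (Fin.castLE hn 2), gen K (Fin.castLE hn 3)⁆⁆ :=
  map_omegaTerm _ _ _ _ _ _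

theorem omega_isOmega (hn : 4 ≤ n) (κ : ℕ) : IsOmega hn κ (omega K hn (κ - 1)) := by
  have h : ∀ i, omega K hn (κ - 1) (gen K i) = relProj K n
      (transvection hn (omegaWord K hn (κ - 1)) (FreeLieAlgebra.of K i)) := fun i => rfl
  constructor
  · rw [h, transvection_of, if_pos rfl, map_add, relProj_omegaWord]
    rfl
  · intro j hj
    rw [h, transvection_of, if_neg hj, add_zero]
    rfl

end Automorphism

end FreeLieTame

/-! ### Existence, uniqueness and non-tameness combined. -/

open FreeLieTame in
theorem corollary4p1 (K : Type*) [Field K] [CharZero K] (n : ℕ) (hn : 4 ≤ n)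
    (κ : ℕ) (hκ : κ = 1 ∨ κ = 2 ∨ κ = 3) :
    (∃! ω : FreeLieTame.RelFree K n ≃ₗ⁅K⁆ FreeLieTame.RelFree K n,
        FreeLieTame.IsOmega hn κ ω) ∧
      ∀ ω : FreeLieTame.RelFree K n ≃ₗ⁅K⁆ FreeLieTame.RelFree K n,
        FreeLieTame.IsOmega hn κ ω → ¬ FreeLieTame.IsTame ω := by
  refine ⟨⟨omega K hn (κ - 1), omega_isOmega hn κ, ?_⟩, ?_⟩
  · intro ω hω
    have h : ω.toLieHom = (omega K hn (κ - 1)).toLieHom := by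
      refine relFree_hom_ext fun i => ?_
      have hΩ := omega_isOmega (K := K) hn κ
      by_cases hi : i = Fin.castLE hn 0
      · rw [hi]
        exact hω.1.trans hΩ.1.symm
      · exact (hω.2 i hi).trans (hΩ.2 i hi).symm
    exact LieEquiv.ext fun r => LieHom.congr_fun h r
  · rintro ω hω ⟨ψ, hψ⟩
    have hψ' : ∀ i, relProj K n (ψ (FreeLieAlgebra.of K i)) = ω (gen K i) := fun i => (hψ _).symm
    refine not_lifts_omega hn (κ - 1) ψ ?_ ?_
    · rw [← relProj_eq_iff, hψ', hω.1, map_add, ← relProj_omegaWord]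
      rfl
    · intro j hj
      rw [← relProj_eq_iff, hψ', hω.2 j hj]
      rfl
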